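/- \textbf{Theorem (0-negative correlation implies lower tail bounds).} Let $X_1,\dots,X_n$ be binary random variables that are $0$-negatively correlated, that is, for all $I\subseteq\{1,\dots,n\}$, $$\Pr[\forall i\in I: X_i=0]\le\prod_{i\in I}\Pr[X_i=0].$$ Let $a_i\le b_i$ be real numbers ($i=1,\dots,n$), and let $Y_1,\dots,Y_n$ be random variables on the same probability space such that almost surely $Y_i=a_i$ if $X_i=0$ and $Y_i=b_i$ if $X_i=1$ (that is, $Y_i=a_i+(b_i-a_i)X_i$). Let $Y=\sum_{i=1}^n Y_i$ and $\sigma^2=\sum_{i=1}^n\mathrm{Var}[Y_i]$. Let $\mu\le E[Y]$ be a real number (in particular, $\mu=E[Y]$ is allowed). Throughout, $0^0=1$. \textbf{1.} Suppose that $a_i,b_i\in[0,1]$ for all $i$. Then for all $\delta\in[0,1]$, the probability $\Pr[Y\le(1-\delta)\mu]$ is at most each of $$\Big(\tfrac{1}{1-\delta}\Big)^{(1-\delta)\mu}\Big(\tfrac{n-\mu}{n-(1-\delta)\mu}\Big)^{n-(1-\delta)\mu},\qquad \Big(\tfrac{e^{-\delta}}{(1-\delta)^{1-\delta}}\Big)^{\mu},\qquad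 \exp\Big(-\tfrac{\delta^2\mu}{2}\Big),$$ where the first bound is read as $(1-\frac{\mu}{n})^n$ for $\delta=1$. Moreover, for all $\lambda\ge0$, the probability $\Pr[Y\le\mu-\lambda]$ is at most each of $$\exp\Big(-\tfrac{2\lambda^2}{n}\Big),\qquad \Big(\tfrac{\mu}{\mu-\lambda}\Big)^{\mu-\lambda}\Big(\tfrac{n-\mu}{n-\mu+\lambda}\Big)^{n-\mu+\lambda},\qquad e^{-\lambda}\Big(\tfrac{\mu}{\mu-\lambda}\Big)^{\mu-\lambda},\qquad \exp\Big(-\tfrac{\lambda^2}{2\mu}\Big),$$ where the second and third bounds are read as $0$ for $\lambda>\mu$ and the factor $(\frac{\mu}{\mu-\lambda})^{\mu-\lambda}$ is read as $1$ for $\lambda=\mu$; and at most each of the variance bounds $$\bigg(\Big(1+\tfrac{\lambda}{\sigma^2}\Big)^{-(1+\frac{\lambda}{\sigma^2})\frac{\sigma^2}{n+\sigma^2}}\Big(1-\tfrac{\lambda}{n}\Big)^{-(1-\frac{\lambda}{n})\frac{n}{n+\sigma^2}}\bigg)^n,$$ $$\exp\Big(-\lambda\Big(\big(1+\tfrac{\sigma^2}{\lambda}\big)\ln\big(1+\tfrac{\lambda}{\sigma^2}\big)-1\Big)\Big)=\exp\Big(-\sigma^2\Big(\big(1+\tfrac{\lambda}{\sigma^2}\big)\ln\big(1+\tfrac{\lambda}{\sigma^2}\big)-\tfrac{\lambda}{\sigma^2}\Big)\Big),$$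 $$\exp\Big(-\tfrac{\lambda^2}{2\sigma^2+\frac23\lambda}\Big),\qquad \exp\Big(-\tfrac13\min\Big\{\tfrac{\lambda^2}{\sigma^2},\lambda\Big\}\Big),$$ where the first of these is read as $0$ for $\lambda>n$ and as $(\frac{\sigma^2}{n+\sigma^2})^n$ for $\lambda=n$. \textbf{2.} Without the assumption $a_i,b_i\in[0,1]$, for all $\lambda\ge0$, $$\Pr[Y\le\mu-\lambda]\le\exp\Big(-\tfrac{2\lambda^2}{\sum_{i=1}^n(b_i-a_i)^2}\Big).$$ If moreover $\beta>0$ is such that almost surely $Y_i\ge E[Y_i]-\beta$ for all $i$, then for all $\lambda\ge0$ the probability $\Pr[Y\le\mu-\lambda]$ is at most each of $$\bigg(\Big(1+\tfrac{\beta\lambda}{\sigma^2}\Big)^{-(1+\frac{\beta\lambda}{\sigma^2})\frac{\sigma^2}{n\beta^2+\sigma^2}}\Big(1-\tfrac{\lambda}{n\beta}\Big)^{-(1-\frac{\lambda}{n\beta})\frac{n\beta^2}{n\beta^2+\sigma^2}}\bigg)^n,$$ $$\exp\Big(-\tfrac{\lambda}{\beta}\Big(\big(1+\tfrac{\sigma^2}{\beta\lambda}\big)\ln\big(1+\tfrac{\beta\lambda}{\sigma^2}\big)-1\Big)\Big),$$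 $$\exp\Big(-\tfrac{\lambda^2}{\sigma^2(2+\frac23\frac{\beta\lambda}{\sigma^2})}\Big),\qquad \exp\Big(-\tfrac13\min\Big\{\tfrac{\lambda^2}{\sigma^2},\tfrac{\lambda}{\beta}\Big\}\Big),$$ where the first of these is read as $0$ for $\lambda>n\beta$ and as $(\frac{\sigma^2}{n\beta^2+\sigma^2})^n$ for $\lambda=n\beta$. In all bounds, expressions with a vanishing denominator that are not covered by these conventions are read as their limits: for $\lambda=0$ or $\delta=0$ they are read as $1$; for $\lambda>0$ and a vanishing denominator $\mu$, $n$, $\sum_i(b_i-a_i)^2$ or $\sigma^2$, the bound is read as the limit when this quantity tends to $0$ from above (so $\min\{\lambda^2/\sigma^2,\lambda/\beta\}=\lambda/\beta$ for $\sigma^2=0$). -/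

import Mathlib

open MeasureTheory ProbabilityTheory

/-- `X₁, …, Xₙ` are `0`-negatively correlated: for every index set `I`, the probability that all
`Xᵢ` with `i ∈ I` vanish is at most the product of the individual probabilities. -/
def ZeroNegativelyCorrelated {Ω : Type*} [MeasurableSpace Ω] (P : Measure Ω) {n : ℕ}
    (X : Fin n → Ω → ℝ) : Prop :=
  ∀ I : Finset (Fin n),
    P.real {ω | ∀ i ∈ I, X i ω = 0} ≤ ∏ i ∈ I, P.real {ω | X i ω = 0}

noncomputable section

/-! ### Multiplicative bounds (`μ` is the mean, `δ ∈ [0,1]` the relative deviation) -/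

/-- `(1/(1-δ))^((1-δ)μ) * ((n-μ)/(n-(1-δ)μ))^(n-(1-δ)μ)`, read as `(1-μ/n)^n` for `δ = 1`.
Real powers follow the convention `0^0 = 1`. -/
def multStrongest (n : ℕ) (μ δ : ℝ) : ℝ :=
  if δ = 1 then (1 - μ / n) ^ n
  else (1 / (1 - δ)) ^ ((1 - δ) * μ) *
    ((n - μ) / (n - (1 - δ) * μ)) ^ (n - (1 - δ) * μ)

/-- `(e^(-δ) / (1-δ)^(1-δ))^μ`. -/
def multStrong (μ δ : ℝ) : ℝ :=
  (Real.exp (-δ) / (1 - δ) ^ (1 - δ)) ^ μ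

/-- `exp(-δ² μ / 2)`. -/
def multEasy (μ δ : ℝ) : ℝ :=
  Real.exp (-(δ ^ 2 * μ / 2))

/-! ### Additive bounds depending on the mean (`lam ≥ 0` is the absolute deviation) -/

/-- `(μ/(μ-λ))^(μ-λ) * ((n-μ)/(n-μ+λ))^(n-μ+λ)`, read as `0` for `λ > μ`
(for `λ = μ` the first factor is `1`). -/
def addStrongest (n : ℕ) (μ lam : ℝ) : ℝ :=
  if μ < lam then 0
  else (μ / (μ - lam)) ^ (μ - lam) *
    ((n - μ) / (n - μ + lam)) ^ (n - μ + lam)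

/-- `e^(-λ) * (μ/(μ-λ))^(μ-λ)`, read as `0` for `λ > μ` (for `λ = μ` the second factor is `1`). -/
def addStrong (μ lam : ℝ) : ℝ :=
  if μ < lam then 0
  else Real.exp (-lam) * (μ / (μ - lam)) ^ (μ - lam)

/-- `exp(-λ²/(2μ))`, read as `0` for `μ = 0 < λ`. -/
def addEasy (μ lam : ℝ) : ℝ :=
  if μ = 0 ∧ 0 < lam then 0 else Real.exp (-(lam ^ 2 / (2 * μ)))

/-! ### Bounds depending on the ranges -/

/-- `exp(-2λ²/s)`, read as `0` for `s = 0 < λ`. -/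
def rangeBound (s lam : ℝ) : ℝ :=
  if s = 0 ∧ 0 < lam then 0 else Real.exp (-(2 * lam ^ 2 / s))

/-! ### Bounds depending on the variance

Here `v` stands for `σ²` and `β > 0` bounds the one-sided deviation of each summand. -/

/-- `((1+βλ/σ²)^(-(1+βλ/σ²) σ²/(nβ²+σ²)) * (1-λ/(nβ))^(-(1-λ/(nβ)) nβ²/(nβ²+σ²)))^n`,
read as `0` for `λ > nβ`, as `(σ²/(nβ²+σ²))^n` for `λ = nβ`, and as its limit `0` for
`σ² = 0 < λ`. -/
def varStrongest (n : ℕ) (β v lam : ℝ) : ℝ :=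
  if n * β < lam then 0
  else if lam = n * β then (v / (n * β ^ 2 + v)) ^ n
  else if v = 0 ∧ 0 < lam then 0
  else ((1 + β * lam / v) ^ (-((1 + β * lam / v) * (v / (n * β ^ 2 + v)))) *
    (1 - lam / (n * β)) ^ (-((1 - lam / (n * β)) * (n * β ^ 2 / (n * β ^ 2 + v))))) ^ n

/-- `exp(-(λ/β) ((1+σ²/(βλ)) ln(1+βλ/σ²) - 1))`, read as its limit `0` for `σ² = 0 < λ`. -/
def varStrong (β v lam : ℝ) : ℝ :=
  if v = 0 ∧ 0 < lam then 0
  else Real.exp (-(lam / β * ((1 + v / (β * lam)) * Real.log (1 + β * lam / v) - 1)))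

/-- `exp(-σ² ((1+λ/σ²) ln(1+λ/σ²) - λ/σ²))`, read as its limit `0` for `σ² = 0 < λ`. -/
def varStrongAlt (v lam : ℝ) : ℝ :=
  if v = 0 ∧ 0 < lam then 0
  else Real.exp (-(v * ((1 + lam / v) * Real.log (1 + lam / v) - lam / v)))

/-- `exp(-λ²/(2σ² + (2/3)βλ))`; the denominator is `σ² (2 + (2/3) βλ/σ²)` with `σ²`
multiplied out. -/
def varLin (β v lam : ℝ) : ℝ :=
  Real.exp (-(lam ^ 2 / (2 * v + 2 / 3 * (β * lam))))

/-- `exp(-(1/3) min{λ²/σ², λ/β})`, where `λ²/σ²` is read as `∞` for `σ² = 0`. -/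
def varMin (β v lam : ℝ) : ℝ :=
  if v = 0 then Real.exp (-(1 / 3 * (lam / β)))
  else Real.exp (-(1 / 3 * min (lam ^ 2 / v) (lam / β)))

end

/-! For `t ≥ 0`, Markov's inequality for `exp (-t Y)` reduces everything to `E[exp (-t Y)]`. Almost
surely each `exp (-t Y_i)` is `c_i + d_i 1{X_i = 0}` with `c_i, d_i ≥ 0`, because `a_i ≤ b_i`.
Expanding the product gives a nonnegative combination of indicators of `{X_i = 0 for all i ∈ I}`, so
0-negative correlation yields `E[exp (-t Y)] ≤ ∏ E[exp (-t Y_i)]`, as under independence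
(`chernoff_of_zeroNegativelyCorrelated`).

What remains concerns single two-point variables. For values in `[0,1]`, chords of the exponential
and AM-GM give a binomial comparison; Hoeffding's lemma gives the range bound; `(eˣ - 1 - x) / x²`
being increasing gives the variance bounds. For the strongest of these, each centred variable is
compared with an extremal two-point law (`two_point_le_bennettMGF`), and concavity in the variance
(`prod_bennettMGF_le`) makes equal variances the worst case. Both binomial-type estimates are
optimised over `t` by `le_relative_entropy_bound`; the weaker bounds follow by calculus. -/

/-! ### Elementary inequalities for exp and log -/

theorem exp_sub_one_sub_eq_integral (x : ℝ) :
    Real.exp x - 1 - x = x ^ 2 * ∫ r in (0 : ℝ)..1, (1 - r) * Real.exp (r * x) := by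
  have h : ∀ r ∈ Set.uIcc (0 : ℝ) 1,
      HasDerivAt (fun r => (1 - r) * x * Real.exp (r * x) + Real.exp (r * x))
        (x ^ 2 * ((1 - r) * Real.exp (r * x))) r := by
    intro r _
    have h1 : HasDerivAt (fun r : ℝ => Real.exp (r * x)) (Real.exp (r * x) * x) r := by
      simpa using ((hasDerivAt_id r).mul_const x).exp
    have h2 : HasDerivAt (fun r : ℝ => (1 - r) * x) (-x) r := by
      simpa using ((hasDerivAt_id r).const_sub 1).mul_const x
    exact ((h2.mul h1).add h1).congr_deriv (by ring)
  rw [← intervalIntegral.integral_const_mul,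
    intervalIntegral.integral_eq_sub_of_hasDerivAt h
      (Continuous.intervalIntegrable (by fun_prop) _ _)]
  simp
  ring

/-- Monotonicity of `x ↦ (eˣ - 1 - x) / x²`, with the denominators cleared. -/
theorem sq_mul_exp_sub_one_sub_le {x y : ℝ} (h : x ≤ y) :
    y ^ 2 * (Real.exp x - 1 - x) ≤ x ^ 2 * (Real.exp y - 1 - y) := by
  rw [exp_sub_one_sub_eq_integral x, exp_sub_one_sub_eq_integral y]
  have : ∫ r in (0 : ℝ)..1, (1 - r) * Real.exp (r * x) ≤
      ∫ r in (0 : ℝ)..1, (1 - r) * Real.exp (r * y) := by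
    refine intervalIntegral.integral_mono_on zero_le_one
      (Continuous.intervalIntegrable (by fun_prop) _ _)
      (Continuous.intervalIntegrable (by fun_prop) _ _) fun r hr => ?_
    have := hr.1
    have := hr.2
    gcongr
  nlinarith [mul_le_mul_of_nonneg_left this (mul_nonneg (sq_nonneg x) (sq_nonneg y))]

/-- This is `2x / (x + 2) ≤ log (1 + x)` at `x = e^y - 1`. -/
theorem two_sub_mul_exp_le {y : ℝ} (hy : 0 ≤ y) : (2 - y) * Real.exp y ≤ 2 + y := by
  have h1 : 1 ≤ Real.exp y := Real.one_le_exp hy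
  have h := Real.le_log_one_add_of_nonneg (x := Real.exp y - 1) (by linarith)
  rw [add_sub_cancel, Real.log_exp, div_le_iff₀ (by linarith)] at h
  linarith

theorem one_sub_mul_exp_sub_one_sub_le {y : ℝ} (hy : 0 ≤ y) :
    (1 - y / 3) * (Real.exp y - 1 - y) ≤ y ^ 2 / 2 := by
  have hd : ∀ z : ℝ, HasDerivAt
      (fun z => z ^ 2 / 2 - (1 - z / 3) * (Real.exp z - 1 - z))
      ((2 + z - (2 - z) * Real.exp z) / 3) z := by
    intro z
    have h1 : HasDerivAt (fun z : ℝ => 1 - z / 3) (-(1 / 3)) z := by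
      simpa using ((hasDerivAt_id z).div_const 3).const_sub 1
    have h2 : HasDerivAt (fun z : ℝ => Real.exp z - 1 - z) (Real.exp z - 1) z := by
      exact ((Real.hasDerivAt_exp z).sub_const 1).sub (hasDerivAt_id z)
    have h3 : HasDerivAt (fun z : ℝ => z ^ 2 / 2) z z := by
      simpa using ((hasDerivAt_id z).pow 2).div_const 2
    exact (h3.sub (h1.mul h2)).congr_deriv (by ring)
  have hm : MonotoneOn (fun z : ℝ => z ^ 2 / 2 - (1 - z / 3) * (Real.exp z - 1 - z))
      (Set.Ici 0) := by
    refine monotoneOn_of_deriv_nonneg (convex_Ici 0)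
      (fun z _ => (hd z).continuousAt.continuousWithinAt)
      (fun z _ => (hd z).differentiableAt.differentiableWithinAt) fun z hz => ?_
    rw [interior_Ici, Set.mem_Ioi] at hz
    rw [(hd z).deriv]
    linarith [two_sub_mul_exp_le hz.le]
  have := hm Set.self_mem_Ici (Set.mem_Ici.2 hy) hy
  simp at this
  linarith

/-- The right side is the Legendre transform of `e^y - 1 - y`, hence at least `x y - (e^y - 1 - y)`
for every `y`. The choice `y = x / (1 + x / 3)` makes `1 - y / 3` the inverse of `1 + x / 3`, which
turns the preceding lemma into an upper bound for `e^y - 1 - y`. -/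
theorem bernstein_le_bennett {x : ℝ} (hx : 0 ≤ x) :
    x ^ 2 / (2 + 2 / 3 * x) ≤ (1 + x) * Real.log (1 + x) - x := by
  have hx1 : 0 < 1 + x := by linarith
  have hx3 : 0 < 1 + x / 3 := by linarith
  set y := x / (1 + x / 3) with hy
  have hy0 : 0 ≤ y := by positivity
  have hxy : y * (1 + x / 3) = x := by rw [hy]; field_simp
  have h1 := one_sub_mul_exp_sub_one_sub_le hy0
  have h2 : (1 - y / 3) * (1 + x / 3) = 1 := by linear_combination -(1 / 3) * hxy
  have h3 : Real.exp y - 1 - y ≤ y ^ 2 / 2 * (1 + x / 3) := by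
    have := mul_le_mul_of_nonneg_right h1 hx3.le
    calc Real.exp y - 1 - y = (1 - y / 3) * (Real.exp y - 1 - y) * (1 + x / 3) := by
          linear_combination -(Real.exp y - 1 - y) * h2
      _ ≤ _ := this
  have h4 := Real.log_le_sub_one_of_pos (div_pos (Real.exp_pos y) hx1)
  rw [Real.log_div (Real.exp_pos y).ne' hx1.ne', Real.log_exp] at h4
  have h5 := mul_le_mul_of_nonneg_left h4 hx1.le
  have h6 : (1 + x) * (Real.exp y / (1 + x) - 1) = Real.exp y - (1 + x) := by field_simp
  rw [h6] at h5
  have h7 : x ^ 2 / (2 + 2 / 3 * x) = x * y - y ^ 2 / 2 * (1 + x / 3) := by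
    rw [hy]; field_simp; ring
  rw [h7]
  linarith

/-- This is `u ≤ sinh u` at `u = log (1 / y)`, multiplied by `y`. -/
theorem sq_sub_one_div_two_le_mul_log {y : ℝ} (h0 : 0 ≤ y) (h1 : y ≤ 1) :
    (y ^ 2 - 1) / 2 ≤ y * Real.log y := by
  rcases h0.eq_or_lt with rfl | h0
  · norm_num
  have h : Real.log y⁻¹ ≤ Real.sinh (Real.log y⁻¹) :=
    Real.self_le_sinh_iff.2 (Real.log_nonneg ((one_le_inv₀ h0).2 h1))
  rw [Real.sinh_log (by positivity), Real.log_inv, inv_inv] at h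
  have h2 := mul_le_mul_of_nonneg_left h h0.le
  have h3 : y * ((y⁻¹ - y) / 2) = (1 - y ^ 2) / 2 := by field_simp
  linarith

/-! ### Bennett's extremal law and concavity in the variance -/

/-- The bound for the moment generating function at `τ` of a centred random variable that is at
most `1` and has variance `w`. -/
noncomputable def bennettMGF (τ w : ℝ) : ℝ :=
  (Real.exp (-(τ * w)) + w * Real.exp τ) / (1 + w)

theorem bennettMGF_pos (τ : ℝ) {w : ℝ} (hw : 0 ≤ w) : 0 < bennettMGF τ w := by
  unfold bennettMGF; positivity

theorem log_bennettMGF (τ : ℝ) {w : ℝ} (hw : 0 ≤ w) :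
    Real.log (bennettMGF τ w) =
      Real.log (1 + w * Real.exp (τ * (1 + w))) - τ * w - Real.log (1 + w) := by
  have h : Real.exp (-(τ * w)) + w * Real.exp τ =
      (1 + w * Real.exp (τ * (1 + w))) * Real.exp (-(τ * w)) := by
    have : Real.exp τ = Real.exp (τ * (1 + w)) * Real.exp (-(τ * w)) := by
      rw [← Real.exp_add]; ring_nf
    rw [this]; ring
  rw [bennettMGF, h, Real.log_div (by positivity) (by positivity),
    Real.log_mul (by positivity) (by positivity), Real.log_exp]
  ring

/-- Nonpositivity of the second derivative in `concaveOn_log_bennettMGF`, denominators cleared, with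
`x = τ (1 + w)` and `v = w`. The part free of `v` is `x ≤ sinh x`; the coefficient of `v` is `1 + x
+ x² / 2 ≤ eˣ`. -/
theorem bennett_second_derivative_aux {x v : ℝ} (hx : 0 ≤ x) (hv : 0 ≤ v) :
    Real.exp x * (2 * x + 2 * x * v + x ^ 2 * v + 2 * v) + 1 ≤ Real.exp x ^ 2 * (1 + 2 * v) := by
  have h1 : 2 * x * Real.exp x + 1 ≤ Real.exp x ^ 2 := by
    have h := Real.self_le_sinh_iff.2 hx
    rw [Real.sinh_eq, Real.exp_neg] at h
    have h2 := mul_le_mul_of_nonneg_left h (Real.exp_pos x).le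
    have h3 : Real.exp x * ((Real.exp x - (Real.exp x)⁻¹) / 2) = (Real.exp x ^ 2 - 1) / 2 := by
      field_simp
    linarith
  have h2 := Real.quadratic_le_exp_of_nonneg hx
  have h3 : 0 ≤ v * Real.exp x * (Real.exp x - (1 + x + x ^ 2 / 2)) :=
    mul_nonneg (by positivity) (by linarith)
  nlinarith

theorem concaveOn_log_bennettMGF {τ : ℝ} (hτ : 0 ≤ τ) :
    ConcaveOn ℝ (Set.Ici 0) fun w => Real.log (bennettMGF τ w) := by
  have hE : ∀ w : ℝ, HasDerivAt (fun w => Real.exp (τ * (1 + w)))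
      (Real.exp (τ * (1 + w)) * τ) w := fun w => by
    simpa using (((hasDerivAt_id w).const_add 1).const_mul τ).exp
  have hh : ∀ w : ℝ, HasDerivAt (fun w => 1 + w * Real.exp (τ * (1 + w)))
      (Real.exp (τ * (1 + w)) * (1 + τ * w)) w := fun w =>
    (((hasDerivAt_id w).mul (hE w)).const_add 1).congr_deriv (by simp; ring)
  have hh2 : ∀ w : ℝ, HasDerivAt (fun w => Real.exp (τ * (1 + w)) * (1 + τ * w))
      (Real.exp (τ * (1 + w)) * (2 * τ + τ ^ 2 * w)) w := fun w =>
    ((hE w).mul (((hasDerivAt_id w).const_mul τ).const_add 1)).congr_deriv (by simp; ring)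
  have hpos : ∀ w : ℝ, 0 ≤ w → 0 < 1 + w * Real.exp (τ * (1 + w)) := fun w hw => by positivity
  have hl : ∀ w : ℝ, HasDerivAt (fun w : ℝ => 1 + w) 1 w := fun w => by
    simpa using (hasDerivAt_id w).const_add 1
  have hd1 : ∀ w : ℝ, 0 ≤ w → HasDerivAt
      (fun w => Real.log (1 + w * Real.exp (τ * (1 + w))) - τ * w - Real.log (1 + w))
      (Real.exp (τ * (1 + w)) * (1 + τ * w) / (1 + w * Real.exp (τ * (1 + w))) - τ
        - 1 / (1 + w)) w := fun w hw => by
    have h1 := (hh w).log (hpos w hw).ne'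
    have h2 : HasDerivAt (fun w => τ * w) τ w := by simpa using (hasDerivAt_id w).const_mul τ
    exact (h1.sub h2).sub ((hl w).log (by positivity))
  have hd2 : ∀ w : ℝ, 0 ≤ w → HasDerivAt
      (fun w => Real.exp (τ * (1 + w)) * (1 + τ * w) / (1 + w * Real.exp (τ * (1 + w))) - τ
        - 1 / (1 + w))
      ((Real.exp (τ * (1 + w)) * (2 * τ + τ ^ 2 * w) * (1 + w * Real.exp (τ * (1 + w)))
        - (Real.exp (τ * (1 + w)) * (1 + τ * w)) * (Real.exp (τ * (1 + w)) * (1 + τ * w)))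
        / (1 + w * Real.exp (τ * (1 + w))) ^ 2 + 1 / (1 + w) ^ 2) w := fun w hw => by
    have h1 := ((hh2 w).div (hh w) (hpos w hw).ne').sub_const τ
    have h2 := (hasDerivAt_const w (1 : ℝ)).div (hl w) (by positivity)
    exact (h1.sub h2).congr_deriv (by ring)
  have key : ConcaveOn ℝ (Set.Ici 0) fun w =>
      Real.log (1 + w * Real.exp (τ * (1 + w))) - τ * w - Real.log (1 + w) := by
    refine concaveOn_of_hasDerivWithinAt2_nonpos (convex_Ici 0)
      (fun w hw => (hd1 w hw).continuousAt.continuousWithinAt)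
      (fun w hw => (hd1 w (interior_subset hw)).hasDerivWithinAt)
      (fun w hw => (hd2 w (interior_subset hw)).hasDerivWithinAt) fun w hw => ?_
    have hw0 : 0 ≤ w := interior_subset hw
    have h := bennett_second_derivative_aux (x := τ * (1 + w)) (by positivity) hw0
    have hp := hpos w hw0
    set E := Real.exp (τ * (1 + w))
    rw [div_add_div _ _ (by positivity) (by positivity)]
    refine div_nonpos_of_nonpos_of_nonneg ?_ (by positivity)
    linear_combination h
  exact key.congr fun w hw => (log_bennettMGF τ hw).symm

/-- Jensen's inequality for the concave logarithm: for a given total variance, equal variances are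
the worst case. -/
theorem prod_bennettMGF_le {n : ℕ} (hn : n ≠ 0) {τ : ℝ} (hτ : 0 ≤ τ) (w : Fin n → ℝ)
    (hw : ∀ i, 0 ≤ w i) :
    ∏ i, bennettMGF τ (w i) ≤ bennettMGF τ ((∑ i, w i) / n) ^ n := by
  have hn' : (0 : ℝ) < n := by positivity
  have hW : 0 ≤ (∑ i, w i) / n := div_nonneg (Finset.sum_nonneg fun i _ => hw i) hn'.le
  have h := (concaveOn_log_bennettMGF hτ).le_map_sum (t := Finset.univ) (w := fun _ => (n : ℝ)⁻¹)
    (p := w) (fun _ _ => by positivity) (by simp [hn]) (fun i _ => hw i)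
  simp only [smul_eq_mul, ← Finset.mul_sum] at h
  rw [inv_mul_eq_div, inv_mul_eq_div, div_le_iff₀ hn',
    ← Real.log_prod (fun i _ => (bennettMGF_pos τ (hw i)).ne'), mul_comm, ← Real.log_pow] at h
  exact (Real.log_le_log_iff (Finset.prod_pos fun i _ => bennettMGF_pos τ (hw i))
    (pow_pos (bennettMGF_pos τ hW) n)).1 h

/-! ### Optimising the exponential parameter -/

theorem tendsto_exp_neg_mul_atTop {c : ℝ} (hc : 0 < c) :
    Filter.Tendsto (fun t : ℝ => Real.exp (-(t * c))) Filter.atTop (nhds 0) :=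
  Real.tendsto_exp_neg_atTop_nhds_zero.comp (Filter.tendsto_id.atTop_mul_const hc)

theorem nonpos_of_forall_le_exp {p c : ℝ} (hc : 0 < c)
    (h : ∀ t : ℝ, 0 ≤ t → p ≤ Real.exp (-(t * c))) : p ≤ 0 :=
  ge_of_tendsto (tendsto_exp_neg_mul_atTop hc) (Filter.eventually_atTop.2 ⟨0, h⟩)

/-- The Chernoff bound for binomial variables, optimised over the exponential parameter. -/
theorem le_relative_entropy_bound {n : ℕ} {p q x : ℝ} (hq : 0 ≤ q) (hqx : q ≤ x) (hx : x ≤ 1)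
    (h : ∀ t : ℝ, 0 ≤ t → p ≤ (Real.exp (-(t * x)) * (1 - q + q * Real.exp t)) ^ n) :
    p ≤ ((q / x) ^ x * ((1 - q) / (1 - x)) ^ (1 - x)) ^ n := by
  -- For `x = 1`, and for `q = 0 < x`, the infimum is only approached as `t → ∞`.
  rcases hx.eq_or_lt with rfl | hx1
  · have ht : Filter.Tendsto
        (fun t : ℝ => (Real.exp (-(t * 1)) * (1 - q + q * Real.exp t)) ^ n) Filter.atTop
        (nhds ((0 * (1 - q) + q) ^ n)) := by
      refine Filter.Tendsto.pow ?_ n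
      have h0 := (Real.tendsto_exp_neg_atTop_nhds_zero.mul_const (1 - q)).add_const q
      refine h0.congr fun t => ?_
      have : Real.exp (-t) * Real.exp t = 1 := by rw [← Real.exp_add]; simp
      rw [mul_one]
      linear_combination -q * this
    simpa using ge_of_tendsto ht (Filter.eventually_atTop.2 ⟨0, h⟩)
  rcases hq.eq_or_lt with rfl | hq0
  · rcases hqx.eq_or_lt with rfl | hx0
    · simpa using h 0 le_rfl
    · have ht : Filter.Tendsto
          (fun t : ℝ => (Real.exp (-(t * x)) * (1 - 0 + 0 * Real.exp t)) ^ n) Filter.atTop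
          (nhds (0 ^ n)) := by
        refine Filter.Tendsto.pow ?_ n
        simpa using tendsto_exp_neg_mul_atTop hx0
      simpa [Real.zero_rpow hx0.ne'] using ge_of_tendsto ht (Filter.eventually_atTop.2 ⟨0, h⟩)
  have hx0 : 0 < x := hq0.trans_le hqx
  have hxc : 0 < 1 - x := by linarith
  have hqc : 0 < 1 - q := by linarith
  have hu : 1 ≤ x * (1 - q) / (q * (1 - x)) := by
    rw [one_le_div (by positivity)]; nlinarith
  -- The minimiser is `t = log (x (1 - q) / (q (1 - x)))`, nonnegative because `q ≤ x`.
  refine (h _ (Real.log_nonneg hu)).trans_eq ?_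
  rw [Real.exp_log (by linarith)]
  congr 1
  have h1 : 1 - q + q * (x * (1 - q) / (q * (1 - x))) = (1 - q) / (1 - x) := by
    field_simp; ring
  have h2 : x * (1 - q) / (q * (1 - x)) = (q / x)⁻¹ * ((1 - q) / (1 - x)) := by
    field_simp
  have hA : 0 < q / x := by positivity
  have hB : 0 < (1 - q) / (1 - x) := by positivity
  rw [h1, h2, Real.log_mul (by positivity) hB.ne', Real.log_inv, Real.rpow_def_of_pos hA,
    Real.rpow_def_of_pos hB]
  conv_lhs => rw [← Real.exp_log hB]
  rw [← Real.exp_add, ← Real.exp_add, Real.exp_log hB]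
  ring_nf

/-! ### Exponential moments of two-point laws -/

theorem sq_mul_exp_mul_sub_le {t z β : ℝ} (ht : 0 ≤ t) (h : z ≤ β) :
    β ^ 2 * (Real.exp (t * z) - 1 - t * z) ≤ z ^ 2 * (Real.exp (t * β) - 1 - t * β) := by
  rcases ht.eq_or_lt with rfl | ht
  · simp
  have h1 := sq_mul_exp_sub_one_sub_le (mul_le_mul_of_nonneg_left h ht.le)
  have h2 : 0 < t ^ 2 := by positivity
  refine le_of_mul_le_mul_left ?_ h2
  linarith

/-- The bound on `z₁` is required only if its mass `q` is positive, since an almost sure bound on a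
variable says nothing about values of mass zero. -/
theorem two_point_sq_mul_exp_le {q z₁ z₂ t β : ℝ} (hq0 : 0 ≤ q) (hq1 : q ≤ 1)
    (ht : 0 ≤ t) (h1 : 0 < q → z₁ ≤ β) (h2 : z₂ ≤ β) :
    β ^ 2 * (q * Real.exp (t * z₁) + (1 - q) * Real.exp (t * z₂) - 1
        - t * (q * z₁ + (1 - q) * z₂)) ≤
      (q * z₁ ^ 2 + (1 - q) * z₂ ^ 2) * (Real.exp (t * β) - 1 - t * β) := by
  have e2 := mul_le_mul_of_nonneg_left (sq_mul_exp_mul_sub_le ht h2) (sub_nonneg.2 hq1)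
  rcases hq0.eq_or_lt with rfl | hq
  · linarith
  have e1 := mul_le_mul_of_nonneg_left (sq_mul_exp_mul_sub_le ht (h1 hq)) hq0
  linarith

theorem two_point_le_exp {q z₁ z₂ t β v : ℝ} (hq0 : 0 ≤ q) (hq1 : q ≤ 1) (ht : 0 ≤ t)
    (hβ : 0 < β) (h1 : 0 < q → z₁ ≤ β) (h2 : z₂ ≤ β) (hz : q * z₁ + (1 - q) * z₂ = 0)
    (hv : q * z₁ ^ 2 + (1 - q) * z₂ ^ 2 = v) :
    q * Real.exp (t * z₁) + (1 - q) * Real.exp (t * z₂) ≤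
      Real.exp (v / β ^ 2 * (Real.exp (t * β) - 1 - t * β)) := by
  have h := two_point_sq_mul_exp_le hq0 hq1 ht h1 h2
  rw [hz, hv] at h
  have h3 := Real.add_one_le_exp (v / β ^ 2 * (Real.exp (t * β) - 1 - t * β))
  refine le_trans ?_ h3
  rw [← sub_le_iff_le_add, div_mul_eq_mul_div, le_div_iff₀ (by positivity)]
  linarith

/-- The extremal centred law lives on `{-s, β}` with `s = v / β`. Shifting by `s` moves it to `{0, β
+ s}`, where the monotonicity estimate is an equality; the shifted variable has mean `s` and second
moment `s (β + s)`. -/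
theorem two_point_le_bennettMGF {q z₁ z₂ t β v : ℝ} (hq0 : 0 ≤ q) (hq1 : q ≤ 1) (ht : 0 ≤ t)
    (hβ : 0 < β) (h1 : 0 < q → z₁ ≤ β) (h2 : z₂ ≤ β) (hz : q * z₁ + (1 - q) * z₂ = 0)
    (hv : q * z₁ ^ 2 + (1 - q) * z₂ ^ 2 = v) :
    q * Real.exp (t * z₁) + (1 - q) * Real.exp (t * z₂) ≤ bennettMGF (t * β) (v / β ^ 2) := by
  have hv0 : 0 ≤ v := by
    have := sub_nonneg.2 hq1
    rw [← hv]; positivity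
  set s := v / β with hs
  have hs0 : 0 ≤ s := by positivity
  have hvs : v = s * β := by rw [hs]; field_simp
  have h := two_point_sq_mul_exp_le (z₁ := z₁ + s) (z₂ := z₂ + s) (β := β + s) hq0 hq1 ht
    (fun hq => by linarith [h1 hq]) (by linarith)
  have e1 : q * (z₁ + s) + (1 - q) * (z₂ + s) = s := by linear_combination hz
  have e2 : q * (z₁ + s) ^ 2 + (1 - q) * (z₂ + s) ^ 2 = s * (β + s) := by
    linear_combination hv + 2 * s * hz + hvs
  rw [e1, e2] at h
  have hp : 0 < β + s := by positivity
  have h' : (β + s) * (q * Real.exp (t * (z₁ + s)) + (1 - q) * Real.exp (t * (z₂ + s))) ≤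
      β + s * Real.exp (t * (β + s)) := by
    refine le_of_mul_le_mul_left ?_ hp
    linarith
  have h3 := mul_le_mul_of_nonneg_right h' (Real.exp_pos (-(t * s))).le
  have hsplit : ∀ z, Real.exp (t * (z + s)) * Real.exp (-(t * s)) = Real.exp (t * z) := fun z => by
    rw [← Real.exp_add]; ring_nf
  have hw : v / β ^ 2 = s / β := by rw [hs]; field_simp
  have hb : bennettMGF (t * β) (v / β ^ 2) =
      (β * Real.exp (-(t * s)) + s * Real.exp (t * β)) / (β + s) := by
    have : t * β * (s / β) = t * s := by field_simp
    rw [bennettMGF, hw, this]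
    field_simp
  rw [hb, le_div_iff₀ hp]
  calc _ = (β + s) * (q * Real.exp (t * (z₁ + s)) + (1 - q) * Real.exp (t * (z₂ + s))) *
        Real.exp (-(t * s)) := by
        rw [← hsplit z₁, ← hsplit z₂]; ring
    _ ≤ _ := h3
    _ = _ := by rw [← hsplit β]; ring

theorem exp_neg_mul_le {t a : ℝ} (ha0 : 0 ≤ a) (ha1 : a ≤ 1) :
    Real.exp (-(t * a)) ≤ 1 - a * (1 - Real.exp (-t)) := by
  have h := convexOn_exp.2 (Set.mem_univ 0) (Set.mem_univ (-t)) (sub_nonneg.2 ha1) ha0 (by ring)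
  simp only [smul_eq_mul, mul_zero, zero_add, Real.exp_zero] at h
  rw [show -(t * a) = a * -t by ring]
  linarith

/-- AM-GM, obtained by multiplying `u ≤ exp (u - 1)` over `u = z i / A`. -/
theorem prod_le_pow_of_sum_le {n : ℕ} {z : Fin n → ℝ} {A : ℝ} (hA : 0 < A)
    (hz : ∀ i, 0 ≤ z i) (h : ∑ i, z i ≤ n * A) : ∏ i, z i ≤ A ^ n := by
  have h1 : ∀ i, z i ≤ A * Real.exp (z i / A - 1) := fun i => by
    have := mul_le_mul_of_nonneg_left (Real.add_one_le_exp (z i / A - 1)) hA.le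
    rwa [sub_add_cancel, mul_div_cancel₀ _ hA.ne'] at this
  calc ∏ i, z i ≤ ∏ i, A * Real.exp (z i / A - 1) :=
        Finset.prod_le_prod (fun i _ => hz i) fun i _ => h1 i
    _ = A ^ n * Real.exp ((∑ i, z i) / A - n) := by
        rw [Finset.prod_mul_distrib, ← Real.exp_sum, Finset.sum_sub_distrib, Finset.sum_div]
        simp
    _ ≤ A ^ n * 1 := by
        gcongr
        rw [Real.exp_le_one_iff, sub_nonpos, div_le_iff₀ hA]
        exact h
    _ = A ^ n := mul_one _

/-! ### Range and variance bounds in closed form -/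

theorem le_rangeBound {p s lam : ℝ} (hs : 0 ≤ s) (hlam : 0 ≤ lam)
    (h : ∀ t : ℝ, 0 ≤ t → p ≤ Real.exp (-(t * lam)) * Real.exp (t ^ 2 * s / 8)) :
    p ≤ rangeBound s lam := by
  unfold rangeBound
  split_ifs with h1
  · refine nonpos_of_forall_le_exp h1.2 fun t ht => ?_
    simpa [h1.1] using h t ht
  · rcases hs.eq_or_lt with rfl | hs
    · simpa using h 0 le_rfl
    -- The minimiser of `t² s / 8 - t λ`.
    · refine (h (4 * lam / s) (by positivity)).trans_eq ?_
      rw [← Real.exp_add]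
      congr 1
      field_simp
      ring

theorem le_varStrong {p β v lam : ℝ} (hβ : 0 < β) (hv : 0 ≤ v) (hlam : 0 ≤ lam)
    (h : ∀ t : ℝ, 0 ≤ t → p ≤ Real.exp (-(t * lam)) *
      Real.exp (v / β ^ 2 * (Real.exp (t * β) - 1 - t * β))) :
    p ≤ varStrong β v lam := by
  unfold varStrong
  split_ifs with h1
  · refine nonpos_of_forall_le_exp h1.2 fun t ht => ?_
    simpa [h1.1] using h t ht
  rcases hlam.eq_or_lt with rfl | hl
  · simpa using h 0 le_rfl
  have hv : 0 < v := hv.lt_of_ne fun h2 => h1 ⟨h2.symm, hl⟩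
  have hx : 0 < 1 + β * lam / v := by positivity
  have hx1 : 0 ≤ Real.log (1 + β * lam / v) := Real.log_nonneg (by
    have : 0 ≤ β * lam / v := by positivity
    linarith)
  -- The stationary point, where `(v / β) (exp (t β) - 1) = λ`.
  refine (h (Real.log (1 + β * lam / v) / β) (by positivity)).trans_eq ?_
  rw [div_mul_cancel₀ _ hβ.ne', Real.exp_log hx, ← Real.exp_add]
  congr 1
  generalize Real.log (1 + β * lam / v) = l
  field_simp
  ring

/-- With `W = v / (n β²)`, `q = W / (1 + W)` and `T = τ (1 + W)`, `bennettMGF τ W` equals `exp (-τ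
W) (1 - q + q exp T)`. After this affine change the estimate is the binomial one. -/
theorem le_varStrongest {n : ℕ} {p β v lam : ℝ} (hn : n ≠ 0) (hβ : 0 < β) (hv : 0 ≤ v)
    (hlam : 0 ≤ lam) (hle : lam ≤ n * β)
    (h : ∀ t : ℝ, 0 ≤ t → p ≤ Real.exp (-(t * lam)) *
      bennettMGF (t * β) (v / (n * β ^ 2)) ^ n) :
    p ≤ varStrongest n β v lam := by
  have hn' : (0 : ℝ) < n := by positivity
  have hden : 0 < n * β ^ 2 + v := by positivity
  set W := v / (n * β ^ 2) with hW
  have hW0 : 0 ≤ W := by positivity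
  have hv0 : W * (n * β ^ 2) = v := by rw [hW]; field_simp
  have hq : W / (1 + W) = v / (n * β ^ 2 + v) := by rw [hW]; field_simp
  have hx : (lam / (n * β) + W) / (1 + W) = (β * lam + v) / (n * β ^ 2 + v) := by
    rw [hW]; field_simp
  have hle' : β * lam ≤ n * β ^ 2 := by nlinarith
  have key := le_relative_entropy_bound (n := n) (p := p) (q := v / (n * β ^ 2 + v))
    (x := (β * lam + v) / (n * β ^ 2 + v)) (by positivity)
    (by gcongr; nlinarith) (by rw [div_le_one hden]; linarith)
    (fun T hT => by
      refine (h (T / (1 + W) / β) (by positivity)).trans_eq ?_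
      rw [← hq, ← hx]
      have e1 : Real.exp (-(T / (1 + W) / β * lam)) =
          Real.exp (-(T / (1 + W) * (lam / (n * β)))) ^ n := by
        rw [← Real.exp_nat_mul]; congr 1; field_simp
      rw [e1, ← mul_pow, div_mul_cancel₀ _ hβ.ne']
      congr 1
      set τ := T / (1 + W) with hτ
      have hT' : T = τ * (1 + W) := by rw [hτ]; field_simp
      have e2 : Real.exp (-(T * ((lam / (n * β) + W) / (1 + W)))) =
          Real.exp (-(τ * (lam / (n * β)))) * Real.exp (-(τ * W)) := by
        rw [← Real.exp_add]; congr 1; rw [hτ]; field_simp; ring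
      have e3 : Real.exp (-(τ * W)) * Real.exp T = Real.exp τ := by
        rw [← Real.exp_add, hT']; congr 1; ring
      rw [e2, bennettMGF, ← e3]
      field_simp
      ring)
  unfold varStrongest
  rw [if_neg (not_lt.2 hle)]
  split_ifs with h1 h2
  · have : (β * lam + v) / (n * β ^ 2 + v) = 1 := by
      rw [div_eq_one_iff_eq hden.ne', h1]; ring
    simpa [this] using key
  · rw [h2.1, zero_div, zero_div, Real.zero_rpow, zero_mul, zero_pow hn] at key
    · exact key
    · have := h2.2
      positivity
  rcases hv.eq_or_lt with hv | hv
  · have : lam = 0 := le_antisymm (not_lt.1 fun h3 => h2 ⟨hv.symm, h3⟩) hlam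
    subst this
    simpa [hW, ← hv, bennettMGF] using h 0 le_rfl
  refine key.trans_eq ?_
  have hlt : lam < n * β := lt_of_le_of_ne hle h1
  have f1 : v / (n * β ^ 2 + v) / ((β * lam + v) / (n * β ^ 2 + v)) = (1 + β * lam / v)⁻¹ := by
    field_simp
    ring
  have f2 : 1 - v / (n * β ^ 2 + v) = n * β ^ 2 / (n * β ^ 2 + v) := by
    field_simp; ring
  have f3 : (β * lam + v) / (n * β ^ 2 + v) = (1 + β * lam / v) * (v / (n * β ^ 2 + v)) := by
    field_simp; ring
  have f4 : 1 - (β * lam + v) / (n * β ^ 2 + v) =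
      (1 - lam / (n * β)) * (n * β ^ 2 / (n * β ^ 2 + v)) := by
    field_simp; ring
  have hy : 0 < 1 - lam / (n * β) := by
    rw [sub_pos, div_lt_one (by positivity)]; exact hlt
  have f5 : (n * β ^ 2 / (n * β ^ 2 + v)) /
      ((1 - lam / (n * β)) * (n * β ^ 2 / (n * β ^ 2 + v))) = (1 - lam / (n * β))⁻¹ := by
    field_simp
  rw [f1, f2, f4, f5, f3, Real.rpow_neg_eq_inv_rpow, Real.rpow_neg_eq_inv_rpow]

theorem varStrong_le_varLin {β v lam : ℝ} (hβ : 0 < β) (hv : 0 ≤ v) (hlam : 0 ≤ lam) :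
    varStrong β v lam ≤ varLin β v lam := by
  unfold varStrong varLin
  split_ifs with h1
  · positivity
  rcases hlam.eq_or_lt with rfl | hl
  · simp
  have hv : 0 < v := hv.lt_of_ne fun h2 => h1 ⟨h2.symm, hl⟩
  have hb := bernstein_le_bennett (x := β * lam / v) (by positivity)
  have hb2 := mul_le_mul_of_nonneg_left hb (show 0 ≤ v / β ^ 2 by positivity)
  rw [Real.exp_le_exp, neg_le_neg_iff]
  generalize Real.log (1 + β * lam / v) = l at *
  calc _ = v / β ^ 2 * ((β * lam / v) ^ 2 / (2 + 2 / 3 * (β * lam / v))) := by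
        field_simp
    _ ≤ _ := hb2
    _ = _ := by field_simp; ring

/-- For `v > 0`, the minimum `m` satisfies `m v ≤ λ²` and `m β λ ≤ λ²`, so `m (2 v + (2/3) β λ) ≤
(8/3) λ² ≤ 3 λ²`. -/
theorem varLin_le_varMin {β v lam : ℝ} (hβ : 0 < β) (hv : 0 ≤ v) (hlam : 0 ≤ lam) :
    varLin β v lam ≤ varMin β v lam := by
  unfold varLin varMin
  rcases hlam.eq_or_lt with rfl | hl
  · simp
  split_ifs with h1
  · rw [Real.exp_le_exp, neg_le_neg_iff, h1, le_div_iff₀ (by positivity)]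
    field_simp
    nlinarith
  have hv : 0 < v := hv.lt_of_ne' h1
  rw [Real.exp_le_exp, neg_le_neg_iff, le_div_iff₀ (by positivity)]
  have m1 := min_le_left (lam ^ 2 / v) (lam / β)
  have m2 := min_le_right (lam ^ 2 / v) (lam / β)
  rw [le_div_iff₀ hv] at m1
  rw [le_div_iff₀ hβ] at m2
  have := mul_le_mul_of_nonneg_right m2 hlam
  nlinarith [sq_nonneg lam]

theorem varStrong_one (v lam : ℝ) (hlam : 0 ≤ lam) : varStrong 1 v lam = varStrongAlt v lam := by
  unfold varStrong varStrongAlt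
  split_ifs with h1
  · rfl
  congr 2
  simp only [one_mul, div_one]
  rcases hlam.eq_or_lt with rfl | hl
  · simp
  have hv : v ≠ 0 := fun h2 => h1 ⟨h2, hl⟩
  generalize Real.log (1 + lam / v) = l
  field_simp
  ring

/-! ### Bounds depending on the mean -/

/-- A lower tail of successes is an upper tail of failures, whence `q = 1 - μ / n` and `x = 1 - (μ -
λ) / n`. -/
theorem le_addStrongest {n : ℕ} {p μ lam : ℝ} (hn : n ≠ 0) (hμ : μ ≤ n)
    (hlam : 0 ≤ lam) (hle : lam ≤ μ)
    (h : ∀ t : ℝ, 0 ≤ t → p ≤ Real.exp (t * (μ - lam)) *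
      (1 - μ / n * (1 - Real.exp (-t))) ^ n) :
    p ≤ addStrongest n μ lam := by
  have hn' : (0 : ℝ) < n := by positivity
  have key := le_relative_entropy_bound (n := n) (p := p) (q := 1 - μ / n)
    (x := 1 - (μ - lam) / n) (by rw [sub_nonneg, div_le_one hn']; exact hμ)
    (by gcongr; linarith) (by
      have : 0 ≤ (μ - lam) / n := div_nonneg (by linarith) hn'.le
      linarith)
    (fun t ht => by
      refine (h t ht).trans_eq ?_
      have e1 : Real.exp (t * (μ - lam)) = Real.exp (t * ((μ - lam) / n)) ^ n := by
        rw [← Real.exp_nat_mul]; congr 1; field_simp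
      rw [e1, ← mul_pow]
      congr 1
      have e2 : Real.exp (-(t * (1 - (μ - lam) / n))) =
          Real.exp (t * ((μ - lam) / n)) * Real.exp (-t) := by
        rw [← Real.exp_add]; ring_nf
      have e3 : Real.exp (-t) * Real.exp t = 1 := by rw [← Real.exp_add]; simp
      rw [e2]
      linear_combination (-(1 - μ / n) * Real.exp (t * ((μ - lam) / n))) * e3)
  unfold addStrongest
  rw [if_neg (not_lt.2 hle)]
  refine key.trans_eq ?_
  have f1 : 1 - μ / n = (n - μ) / n := by field_simp
  have f2 : 1 - (μ - lam) / n = (n - μ + lam) / n := by field_simp; ring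
  rw [sub_sub_cancel, sub_sub_cancel, f1, f2, div_div_div_cancel_right₀ hn'.ne',
    div_div_div_cancel_right₀ hn'.ne', mul_pow,
    ← Real.rpow_mul_natCast (div_nonneg (by linarith) (by linarith)),
    ← Real.rpow_mul_natCast (div_nonneg (by linarith) (by linarith)),
    div_mul_cancel₀ _ hn'.ne', div_mul_cancel₀ _ hn'.ne', mul_comm]

theorem addStrongest_le_addStrong {n : ℕ} {μ lam : ℝ} (hμ : μ ≤ n) (hlam : 0 ≤ lam) :
    addStrongest n μ lam ≤ addStrong μ lam := by
  unfold addStrongest addStrong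
  split_ifs with h1
  · exact le_rfl
  rw [not_lt] at h1
  rw [mul_comm]
  refine mul_le_mul_of_nonneg_right ?_ (Real.rpow_nonneg (div_nonneg (by linarith) (by linarith)) _)
  have hD : 0 ≤ n - μ + lam := by linarith
  rcases hD.eq_or_lt with hD | hD
  · rw [← hD, Real.rpow_zero, Real.one_le_exp_iff]; linarith
  -- Raised to the power `n - μ + λ`, this bounds the second factor by `exp (-λ)`.
  have h2 : (n - μ) / (n - μ + lam) ≤ Real.exp (-(lam / (n - μ + lam))) := by
    refine le_trans (le_of_eq ?_) (Real.add_one_le_exp _)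
    field_simp
    ring
  refine (Real.rpow_le_rpow (div_nonneg (by linarith) hD.le) h2 hD.le).trans_eq ?_
  rw [← Real.exp_mul]
  congr 1
  field_simp

theorem addStrong_le_addEasy {μ lam : ℝ} (hlam : 0 ≤ lam) :
    addStrong μ lam ≤ addEasy μ lam := by
  unfold addStrong addEasy
  split_ifs with h1 h2 h2
  · exact le_rfl
  · positivity
  · exact absurd (h2.1 ▸ h2.2) h1
  rw [not_lt] at h1
  rcases (hlam.trans h1).eq_or_lt with hμ | hμ
  · have : lam = 0 := by linarith
    simp [← hμ, this]
  -- In terms of `y` the claim is `(y² - 1) / 2 ≤ y log y`, scaled by `μ`.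
  set y := (μ - lam) / μ with hy
  have hy0 : 0 ≤ y := div_nonneg (by linarith) hμ.le
  have hy1 : y ≤ 1 := by rw [hy, div_le_one hμ]; linarith
  have hl : lam = μ * (1 - y) := by rw [hy]; field_simp; ring
  have hml : μ - lam = μ * y := by rw [hl]; ring
  have hr : (μ / (μ - lam)) ^ (μ - lam) = Real.exp (-(μ * (y * Real.log y))) := by
    rcases hy0.eq_or_lt with h0 | h0
    · rw [hml, ← h0]; simp
    · rw [hml, div_mul_cancel_left₀ hμ.ne', Real.rpow_def_of_pos (inv_pos.2 h0), Real.log_inv]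
      ring_nf
  rw [hr, ← Real.exp_add, Real.exp_le_exp]
  have h3 := mul_le_mul_of_nonneg_left (sq_sub_one_div_two_le_mul_log hy0 hy1) hμ.le
  have h4 : lam ^ 2 / (2 * μ) = μ * (1 - y) ^ 2 / 2 := by rw [hl]; field_simp
  rw [h4, hl]
  linarith

theorem multStrongest_eq {n : ℕ} {μ δ : ℝ} (hμ : 0 ≤ μ) (hμn : μ ≤ n) (hδ : δ ≤ 1) :
    multStrongest n μ δ = addStrongest n μ (δ * μ) := by
  unfold multStrongest addStrongest
  rw [if_neg (show ¬μ < δ * μ by nlinarith)]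
  split_ifs with h1
  · subst h1
    rcases Nat.eq_zero_or_pos n with rfl | hn
    · have : μ = 0 := le_antisymm (by simpa using hμn) hμ
      simp [this]
    · have : (0 : ℝ) < n := by positivity
      simp [sub_div, this.ne']
  · have hδ' : 1 - δ ≠ 0 := sub_ne_zero.2 (Ne.symm h1)
    rw [show μ - δ * μ = (1 - δ) * μ by ring, show n - μ + δ * μ = n - (1 - δ) * μ by ring]
    rcases hμ.eq_or_lt with rfl | hμ
    · simp
    · rw [div_mul_cancel_right₀ hμ.ne', one_div]

theorem multStrong_eq {μ δ : ℝ} (hμ : 0 ≤ μ) (hδ : δ ≤ 1) :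
    multStrong μ δ = addStrong μ (δ * μ) := by
  unfold multStrong addStrong
  rw [if_neg (by nlinarith)]
  have hδ' : 0 ≤ 1 - δ := sub_nonneg.2 hδ
  rcases hμ.eq_or_lt with rfl | hμ
  · simp
  rw [show μ - δ * μ = (1 - δ) * μ by ring, div_mul_cancel_right₀ hμ.ne',
    Real.div_rpow (Real.exp_pos _).le (by positivity), ← Real.exp_mul, Real.rpow_mul
    (by positivity), Real.inv_rpow hδ', Real.inv_rpow (by positivity), neg_mul, div_eq_mul_inv]

theorem multEasy_eq {μ δ : ℝ} : multEasy μ δ = addEasy μ (δ * μ) := by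
  unfold multEasy addEasy
  rcases eq_or_ne μ 0 with rfl | hμ
  · simp
  · rw [if_neg fun h => hμ h.1]
    congr 2
    field_simp

/-! ### Two-valued random variables and the Chernoff bound -/

section TwoPoint

variable {Ω : Type*} [MeasurableSpace Ω] {P : Measure Ω}

/-- Every function of `Y` is affine in the indicator of `X = 0`, so expectations, and products to be
expanded, involve only these indicators. -/
theorem comp_two_point_ae_eq {X Y : Ω → ℝ} {a b : ℝ} (hbin : ∀ᵐ ω ∂P, X ω = 0 ∨ X ω = 1)
    (hY : ∀ᵐ ω ∂P, (X ω = 0 → Y ω = a) ∧ (X ω = 1 → Y ω = b)) (f : ℝ → ℝ) :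
    (fun ω => f (Y ω)) =ᵐ[P]
      fun ω => f b + (f a - f b) * {ω | X ω = 0}.indicator (fun _ => (1 : ℝ)) ω := by
  filter_upwards [hbin, hY] with ω h1 h2
  rcases h1 with h | h
  · simp [h, h2.1 h]
  · simp [h, h2.2 h]

theorem nullMeasurableSet_eq_zero {X : Ω → ℝ} (hX : AEMeasurable X P) :
    NullMeasurableSet {ω | X ω = 0} P :=
  hX.nullMeasurable (measurableSet_singleton 0)

theorem aemeasurable_two_point {X Y : Ω → ℝ} {a b : ℝ} (hX : AEMeasurable X P)
    (hbin : ∀ᵐ ω ∂P, X ω = 0 ∨ X ω = 1)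
    (hY : ∀ᵐ ω ∂P, (X ω = 0 → Y ω = a) ∧ (X ω = 1 → Y ω = b)) : AEMeasurable Y P :=
  AEMeasurable.congr (((aemeasurable_const.indicator₀
    (nullMeasurableSet_eq_zero hX)).const_mul _).const_add _)
    (comp_two_point_ae_eq hbin hY id).symm

theorem mem_Icc_two_point {X Y : Ω → ℝ} {a b : ℝ} (hab : a ≤ b)
    (hbin : ∀ᵐ ω ∂P, X ω = 0 ∨ X ω = 1)
    (hY : ∀ᵐ ω ∂P, (X ω = 0 → Y ω = a) ∧ (X ω = 1 → Y ω = b)) :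
    ∀ᵐ ω ∂P, Y ω ∈ Set.Icc a b := by
  filter_upwards [hbin, hY] with ω h1 h2
  rcases h1 with h | h
  · rw [h2.1 h]; exact Set.left_mem_Icc.2 hab
  · rw [h2.2 h]; exact Set.right_mem_Icc.2 hab

theorem measureReal_le_eq_zero {f : Ω → ℝ} {c x : ℝ} (hf : ∀ᵐ ω ∂P, c ≤ f ω) (hx : x < c) :
    P.real {ω | f ω ≤ x} = 0 := by
  have : P {ω | f ω ≤ x} = 0 := by
    refine measure_mono_null (fun ω hω => ?_) (ae_iff.1 hf)
    exact not_le.2 (lt_of_le_of_lt hω hx)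
  simp [measureReal_def, this]

theorem two_point_sub_le {X Y : Ω → ℝ} {a b β : ℝ}
    (hY : ∀ᵐ ω ∂P, (X ω = 0 → Y ω = a) ∧ (X ω = 1 → Y ω = b)) {m : ℝ}
    (hβ : ∀ᵐ ω ∂P, m - β ≤ Y ω) (hq : 0 < P.real {ω | X ω = 0}) : m - a ≤ β := by
  by_contra hlt
  have : ∀ᵐ ω ∂P, ¬X ω = 0 := by
    filter_upwards [hY, hβ] with ω h1 h2 h3
    rw [h1.1 h3] at h2
    linarith
  have h0 : P {ω | X ω = 0} = 0 := by simpa [ae_iff] using this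
  simp [measureReal_def, h0] at hq

variable [IsProbabilityMeasure P]

theorem integral_comp_two_point {X Y : Ω → ℝ} {a b : ℝ} (hX : AEMeasurable X P)
    (hbin : ∀ᵐ ω ∂P, X ω = 0 ∨ X ω = 1)
    (hY : ∀ᵐ ω ∂P, (X ω = 0 → Y ω = a) ∧ (X ω = 1 → Y ω = b)) (f : ℝ → ℝ) :
    ∫ ω, f (Y ω) ∂P = P.real {ω | X ω = 0} * f a + (1 - P.real {ω | X ω = 0}) * f b := by
  have hA := nullMeasurableSet_eq_zero hX
  rw [integral_congr_ae (comp_two_point_ae_eq hbin hY f), integral_add (integrable_const _)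
    (((integrable_const (1 : ℝ)).indicator₀ hA).const_mul _), integral_const_mul,
    integral_indicator₀ hA]
  simp
  ring

/-- For `0`-negatively correlated variables, the expectation of a product of decreasing functions
of the single variables is at most the product of the expectations. -/
theorem integral_prod_le_of_zeroNegativelyCorrelated {n : ℕ} {X : Fin n → Ω → ℝ}
    (hXm : ∀ i, AEMeasurable (X i) P) (hXneg : ZeroNegativelyCorrelated P X)
    {c d : Fin n → ℝ} (hc : ∀ i, 0 ≤ c i) (hd : ∀ i, 0 ≤ d i) :
    ∫ ω, ∏ i, (c i + d i * {ω | X i ω = 0}.indicator (fun _ => (1 : ℝ)) ω) ∂P ≤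
      ∏ i, (c i + d i * P.real {ω | X i ω = 0}) := by
  have hset : ∀ I : Finset (Fin n), NullMeasurableSet {ω | ∀ i ∈ I, X i ω = 0} P := fun I => by
    have : {ω | ∀ i ∈ I, X i ω = 0} = ⋂ i ∈ I, {ω | X i ω = 0} := by ext; simp
    rw [this]
    exact I.nullMeasurableSet_biInter fun i _ => nullMeasurableSet_eq_zero (hXm i)
  have hprod : ∀ (I : Finset (Fin n)) (ω : Ω),
      ∏ i ∈ I, d i * {ω | X i ω = 0}.indicator (fun _ => (1 : ℝ)) ω =
        (∏ i ∈ I, d i) * {ω | ∀ i ∈ I, X i ω = 0}.indicator (fun _ => (1 : ℝ)) ω := fun I ω => by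
    rw [Finset.prod_mul_distrib]
    congr 1
    by_cases h : ∀ i ∈ I, X i ω = 0
    · rw [Set.indicator_of_mem (by exact h)]
      exact Finset.prod_eq_one fun i hi => Set.indicator_of_mem (by exact h i hi) _
    · rw [Set.indicator_of_notMem (by exact h)]
      push Not at h
      obtain ⟨i, hi, hne⟩ := h
      exact Finset.prod_eq_zero hi (Set.indicator_of_notMem (by exact hne) _)
  -- Expansion over subsets `I`: all coefficients are nonnegative, so the correlation hypothesis
  -- applies term by term.
  simp_rw [add_comm (c _), Finset.prod_add, hprod]
  rw [integral_finsetSum _ fun I _ =>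
    ((((integrable_const (1 : ℝ)).indicator₀ (hset I)).const_mul _).mul_const _)]
  refine Finset.sum_le_sum fun I _ => ?_
  rw [integral_mul_const, integral_const_mul, integral_indicator₀ (hset I),
    Finset.prod_mul_distrib]
  refine mul_le_mul_of_nonneg_right ?_ (Finset.prod_nonneg fun i _ => hc i)
  refine mul_le_mul_of_nonneg_left ?_ (Finset.prod_nonneg fun i _ => hd i)
  simpa using hXneg I

theorem chernoff_of_zeroNegativelyCorrelated {n : ℕ} {X Y : Fin n → Ω → ℝ} {a b : Fin n → ℝ}
    (hXm : ∀ i, AEMeasurable (X i) P) (hXbin : ∀ i, ∀ᵐ ω ∂P, X i ω = 0 ∨ X i ω = 1)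
    (hXneg : ZeroNegativelyCorrelated P X) (hab : ∀ i, a i ≤ b i)
    (hY : ∀ i, ∀ᵐ ω ∂P, (X i ω = 0 → Y i ω = a i) ∧ (X i ω = 1 → Y i ω = b i))
    (x : ℝ) {t : ℝ} (ht : 0 ≤ t) :
    P.real {ω | ∑ i, Y i ω ≤ x} ≤ Real.exp (t * x) *
      ∏ i, (P.real {ω | X i ω = 0} * Real.exp (-(t * a i)) +
        (1 - P.real {ω | X i ω = 0}) * Real.exp (-(t * b i))) := by
  have hae : (fun ω => Real.exp (-t * ∑ i, Y i ω)) =ᵐ[P] fun ω =>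
      ∏ i, (Real.exp (-(t * b i)) + (Real.exp (-(t * a i)) - Real.exp (-(t * b i))) *
        {ω | X i ω = 0}.indicator (fun _ => (1 : ℝ)) ω) := by
    have := ae_all_iff.2 fun i =>
      comp_two_point_ae_eq (hXbin i) (hY i) fun y => Real.exp (-(t * y))
    filter_upwards [this] with ω hω
    rw [Finset.mul_sum, Real.exp_sum]
    refine Finset.prod_congr rfl fun i _ => ?_
    rw [← hω i, neg_mul]
  have hYm : ∀ i, AEMeasurable (Y i) P := fun i =>
    aemeasurable_two_point (hXm i) (hXbin i) (hY i)
  have hint : Integrable (fun ω => Real.exp (-t * ∑ i, Y i ω)) P := by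
    have hmeas : AEMeasurable (fun ω => Real.exp (-t * ∑ i, Y i ω)) P :=
      Real.measurable_exp.comp_aemeasurable
        ((Finset.aemeasurable_fun_sum _ fun i _ => hYm i).const_mul _)
    refine Integrable.of_bound hmeas.aestronglyMeasurable
      (∏ i, (Real.exp (-(t * b i)) + |Real.exp (-(t * a i)) - Real.exp (-(t * b i))|)) ?_
    filter_upwards [hae] with ω hω
    rw [hω, Real.norm_eq_abs, Finset.abs_prod]
    refine Finset.prod_le_prod (fun _ _ => abs_nonneg _) fun i _ => ?_
    refine (abs_add_le _ _).trans ?_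
    rw [abs_mul, Real.abs_exp]
    gcongr
    refine mul_le_of_le_one_right (abs_nonneg _) ?_
    by_cases h : X i ω = 0 <;> simp [h]
  have h := measure_le_le_exp_mul_mgf (μ := P) (X := fun ω => ∑ i, Y i ω) x
    (neg_nonpos.2 ht) hint
  rw [neg_neg] at h
  refine h.trans (mul_le_mul_of_nonneg_left ?_ (Real.exp_pos _).le)
  rw [mgf, integral_congr_ae hae]
  refine (integral_prod_le_of_zeroNegativelyCorrelated hXm hXneg (fun i => (Real.exp_pos _).le)
    fun i => sub_nonneg.2 (Real.exp_le_exp.2 (neg_le_neg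
      (mul_le_mul_of_nonneg_left (hab i) ht)))).trans_eq ?_
  refine Finset.prod_congr rfl fun i _ => by ring

theorem two_point_hoeffding {X Y : Ω → ℝ} {a b : ℝ} (hX : AEMeasurable X P) (hab : a ≤ b)
    (hbin : ∀ᵐ ω ∂P, X ω = 0 ∨ X ω = 1)
    (hY : ∀ᵐ ω ∂P, (X ω = 0 → Y ω = a) ∧ (X ω = 1 → Y ω = b)) (t : ℝ) :
    P.real {ω | X ω = 0} * Real.exp (t * ((∫ ω, Y ω ∂P) - a)) +
        (1 - P.real {ω | X ω = 0}) * Real.exp (t * ((∫ ω, Y ω ∂P) - b)) ≤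
      Real.exp (t ^ 2 * (b - a) ^ 2 / 8) := by
  -- Hoeffding's lemma, taken at `-t` because the tail is a lower one.
  have h := (hasSubgaussianMGF_of_mem_Icc (aemeasurable_two_point hX hbin hY)
    (mem_Icc_two_point hab hbin hY)).mgf_le (-t)
  rw [mgf, integral_comp_two_point hX hbin hY
    fun y => Real.exp (-t * (y - ∫ ω, Y ω ∂P))] at h
  refine (le_of_eq ?_).trans (h.trans_eq ?_)
  · ring_nf
  · congr 1
    simp only [NNReal.coe_pow, NNReal.coe_div, coe_nnnorm, Real.norm_eq_abs, NNReal.coe_ofNat,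
      div_pow, sq_abs]
    ring

end TwoPoint

/-! ### Lower tails of the sum -/

section LowerTail

variable {Ω : Type*} [MeasurableSpace Ω] {P : Measure Ω} [IsProbabilityMeasure P] {n : ℕ}
  {X Y : Fin n → Ω → ℝ} {a b : Fin n → ℝ}

theorem integral_sum_two_point (hXm : ∀ i, AEMeasurable (X i) P)
    (hXbin : ∀ i, ∀ᵐ ω ∂P, X i ω = 0 ∨ X i ω = 1) (hab : ∀ i, a i ≤ b i)
    (hY : ∀ i, ∀ᵐ ω ∂P, (X i ω = 0 → Y i ω = a i) ∧ (X i ω = 1 → Y i ω = b i)) :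
    ∫ ω, ∑ i, Y i ω ∂P = ∑ i, ∫ ω, Y i ω ∂P :=
  integral_finsetSum _ fun i _ => Integrable.of_mem_Icc (a i) (b i)
    (aemeasurable_two_point (hXm i) (hXbin i) (hY i)) (mem_Icc_two_point (hab i) (hXbin i) (hY i))

/-- The Chernoff bound in terms of the centred variables. -/
theorem centered_chernoff (hXm : ∀ i, AEMeasurable (X i) P)
    (hXbin : ∀ i, ∀ᵐ ω ∂P, X i ω = 0 ∨ X i ω = 1) (hXneg : ZeroNegativelyCorrelated P X)
    (hab : ∀ i, a i ≤ b i)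
    (hY : ∀ i, ∀ᵐ ω ∂P, (X i ω = 0 → Y i ω = a i) ∧ (X i ω = 1 → Y i ω = b i))
    {μ : ℝ} (hμ : μ ≤ ∫ ω, ∑ i, Y i ω ∂P) (lam : ℝ) {t : ℝ} (ht : 0 ≤ t) {g : Fin n → ℝ}
    (hg : ∀ i, P.real {ω | X i ω = 0} * Real.exp (t * ((∫ ω, Y i ω ∂P) - a i)) +
        (1 - P.real {ω | X i ω = 0}) * Real.exp (t * ((∫ ω, Y i ω ∂P) - b i)) ≤ g i) :
    P.real {ω | ∑ i, Y i ω ≤ μ - lam} ≤ Real.exp (-(t * lam)) * ∏ i, g i := by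
  rw [integral_sum_two_point hXm hXbin hab hY] at hμ
  have hq1 : ∀ i, 0 ≤ 1 - P.real {ω | X i ω = 0} := fun i => sub_nonneg.2 measureReal_le_one
  refine (chernoff_of_zeroNegativelyCorrelated hXm hXbin hXneg hab hY (μ - lam) ht).trans ?_
  -- As `t ≥ 0`, `μ` may be replaced by the larger mean, whose exponential then centres each factor.
  have hx : Real.exp (t * (μ - lam)) ≤
      Real.exp (-(t * lam)) * ∏ i, Real.exp (t * ∫ ω, Y i ω ∂P) := by
    rw [← Real.exp_sum, ← Finset.mul_sum, ← Real.exp_add, Real.exp_le_exp]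
    linarith [mul_le_mul_of_nonneg_left hμ ht]
  refine (mul_le_mul_of_nonneg_right hx (Finset.prod_nonneg fun i _ => ?_)).trans ?_
  · have := hq1 i; positivity
  rw [mul_assoc, ← Finset.prod_mul_distrib]
  refine mul_le_mul_of_nonneg_left (Finset.prod_le_prod (fun i _ => ?_) fun i _ => ?_)
    (Real.exp_pos _).le
  · have := hq1 i; positivity
  · refine (le_of_eq ?_).trans (hg i)
    simp only [sub_eq_add_neg, mul_add, Real.exp_add, mul_neg]
    ring

theorem lower_tail_le_rangeBound (hXm : ∀ i, AEMeasurable (X i) P)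
    (hXbin : ∀ i, ∀ᵐ ω ∂P, X i ω = 0 ∨ X i ω = 1) (hXneg : ZeroNegativelyCorrelated P X)
    (hab : ∀ i, a i ≤ b i)
    (hY : ∀ i, ∀ᵐ ω ∂P, (X i ω = 0 → Y i ω = a i) ∧ (X i ω = 1 → Y i ω = b i))
    {μ : ℝ} (hμ : μ ≤ ∫ ω, ∑ i, Y i ω ∂P) {s lam : ℝ} (hlam : 0 ≤ lam)
    (hs : ∑ i, (b i - a i) ^ 2 ≤ s) :
    P.real {ω | ∑ i, Y i ω ≤ μ - lam} ≤ rangeBound s lam := by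
  refine le_rangeBound ((Finset.sum_nonneg fun i _ => sq_nonneg _).trans hs) hlam fun t ht => ?_
  refine (centered_chernoff hXm hXbin hXneg hab hY hμ lam ht fun i =>
    two_point_hoeffding (hXm i) (hab i) (hXbin i) (hY i) t).trans ?_
  rw [← Real.exp_sum, ← Finset.sum_div, ← Finset.mul_sum]
  gcongr

theorem lower_tail_variance (hXm : ∀ i, AEMeasurable (X i) P)
    (hXbin : ∀ i, ∀ᵐ ω ∂P, X i ω = 0 ∨ X i ω = 1) (hXneg : ZeroNegativelyCorrelated P X)
    (hab : ∀ i, a i ≤ b i)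
    (hY : ∀ i, ∀ᵐ ω ∂P, (X i ω = 0 → Y i ω = a i) ∧ (X i ω = 1 → Y i ω = b i))
    {μ : ℝ} (hμ : μ ≤ ∫ ω, ∑ i, Y i ω ∂P) {β : ℝ} (hβ : 0 < β)
    (hYβ : ∀ i, ∀ᵐ ω ∂P, (∫ ω', Y i ω' ∂P) - β ≤ Y i ω) {lam : ℝ} (hlam : 0 ≤ lam) :
    P.real {ω | ∑ i, Y i ω ≤ μ - lam} ≤ varStrongest n β (∑ i, variance (Y i) P) lam ∧
    P.real {ω | ∑ i, Y i ω ≤ μ - lam} ≤ varStrong β (∑ i, variance (Y i) P) lam := by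
  have hm : ∀ i, ∫ ω, Y i ω ∂P = P.real {ω | X i ω = 0} * a i +
      (1 - P.real {ω | X i ω = 0}) * b i := fun i =>
    integral_comp_two_point (hXm i) (hXbin i) (hY i) id
  have hz : ∀ i, P.real {ω | X i ω = 0} * ((∫ ω, Y i ω ∂P) - a i) +
      (1 - P.real {ω | X i ω = 0}) * ((∫ ω, Y i ω ∂P) - b i) = 0 := fun i => by
    linear_combination hm i
  have hq1 : ∀ i, P.real {ω | X i ω = 0} ≤ 1 := fun i => measureReal_le_one
  have hv : ∀ i, P.real {ω | X i ω = 0} * ((∫ ω, Y i ω ∂P) - a i) ^ 2 +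
      (1 - P.real {ω | X i ω = 0}) * ((∫ ω, Y i ω ∂P) - b i) ^ 2 = variance (Y i) P := fun i => by
    rw [variance_eq_integral (aemeasurable_two_point (hXm i) (hXbin i) (hY i)),
      integral_comp_two_point (hXm i) (hXbin i) (hY i) fun y => (y - ∫ ω, Y i ω ∂P) ^ 2]
    ring
  have h1 : ∀ i, 0 < P.real {ω | X i ω = 0} → (∫ ω, Y i ω ∂P) - a i ≤ β := fun i =>
    two_point_sub_le (hY i) (hYβ i)
  have h2 : ∀ i, (∫ ω, Y i ω ∂P) - b i ≤ β := fun i => by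
    have := mul_le_mul_of_nonneg_left (hab i)
      (measureReal_nonneg (μ := P) (s := {ω | X i ω = 0}))
    linarith [hm i]
  have hv0 : ∀ i, 0 ≤ variance (Y i) P := fun i => variance_nonneg _ _
  have hV0 : 0 ≤ ∑ i, variance (Y i) P := Finset.sum_nonneg fun i _ => hv0 i
  refine ⟨?_, le_varStrong hβ hV0 hlam fun t ht => ?_⟩
  · rcases lt_or_ge (n * β) lam with hlt | hle
    -- Almost surely the sum is at least its mean minus `n β`, which exceeds `μ - λ`; the event is
    -- null.
    · rw [varStrongest, if_pos hlt]
      rw [integral_sum_two_point hXm hXbin hab hY] at hμ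
      refine (measureReal_le_eq_zero (f := fun ω => ∑ i, Y i ω)
        (c := ∑ i, ((∫ ω, Y i ω ∂P) - β)) ?_ ?_).le
      · filter_upwards [ae_all_iff.2 hYβ] with ω hω
        exact Finset.sum_le_sum fun i _ => hω i
      · simp only [Finset.sum_sub_distrib, Finset.sum_const, Finset.card_univ, Fintype.card_fin,
          nsmul_eq_mul]
        linarith
    rcases eq_or_ne n 0 with rfl | hn
    · have : lam = 0 := le_antisymm (by simpa using hle) hlam
      refine measureReal_le_one.trans_eq ?_
      simp [varStrongest, this]
    refine le_varStrongest hn hβ hV0 hlam hle fun t ht => ?_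
    refine (centered_chernoff hXm hXbin hXneg hab hY hμ lam ht fun i =>
      two_point_le_bennettMGF measureReal_nonneg (hq1 i) ht hβ (h1 i) (h2 i) (hz i)
        (hv i)).trans ?_
    refine mul_le_mul_of_nonneg_left ?_ (Real.exp_pos _).le
    refine (prod_bennettMGF_le hn (mul_nonneg ht hβ.le) _ fun i =>
      div_nonneg (hv0 i) (sq_nonneg β)).trans_eq ?_
    rw [← Finset.sum_div, div_div, mul_comm (β ^ 2)]
  · refine (centered_chernoff hXm hXbin hXneg hab hY hμ lam ht fun i =>
      two_point_le_exp measureReal_nonneg (hq1 i) ht hβ (h1 i) (h2 i) (hz i) (hv i)).trans_eq ?_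
    rw [← Real.exp_sum, ← Finset.sum_mul, ← Finset.sum_div]

/-- Chords of the exponential bound each factor by `1 - E[Y_i] (1 - exp (-t))`. AM-GM then needs
only the sum of the means, and the result decreases in that sum, so `μ ≤ E[Y]` suffices. -/
theorem lower_tail_le_addStrongest (hXm : ∀ i, AEMeasurable (X i) P)
    (hXbin : ∀ i, ∀ᵐ ω ∂P, X i ω = 0 ∨ X i ω = 1) (hXneg : ZeroNegativelyCorrelated P X)
    (hab : ∀ i, a i ≤ b i)
    (hY : ∀ i, ∀ᵐ ω ∂P, (X i ω = 0 → Y i ω = a i) ∧ (X i ω = 1 → Y i ω = b i))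
    {μ : ℝ} (hμ : μ ≤ ∫ ω, ∑ i, Y i ω ∂P) (ha : ∀ i, 0 ≤ a i) (hb : ∀ i, b i ≤ 1)
    (hμn : μ ≤ n) {lam : ℝ} (hlam : 0 ≤ lam) (hle : lam ≤ μ) :
    P.real {ω | ∑ i, Y i ω ≤ μ - lam} ≤ addStrongest n μ lam := by
  rcases eq_or_ne n 0 with rfl | hn
  · have hμ0 : μ = 0 := le_antisymm (by simpa using hμn) (hlam.trans hle)
    have hl0 : lam = 0 := le_antisymm (hle.trans hμ0.le) hlam
    refine measureReal_le_one.trans_eq ?_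
    simp [addStrongest, hμ0, hl0]
  refine le_addStrongest hn hμn hlam hle fun t ht => ?_
  refine (chernoff_of_zeroNegativelyCorrelated hXm hXbin hXneg hab hY (μ - lam) ht).trans ?_
  refine mul_le_mul_of_nonneg_left ?_ (Real.exp_pos _).le
  rw [integral_sum_two_point hXm hXbin hab hY] at hμ
  have hn' : (0 : ℝ) < n := by positivity
  have hw : 0 ≤ 1 - Real.exp (-t) := by
    rw [sub_nonneg, Real.exp_le_one_iff]; linarith
  have hq1 : ∀ i, 0 ≤ 1 - P.real {ω | X i ω = 0} := fun i => sub_nonneg.2 measureReal_le_one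
  have hA : 0 < 1 - μ / n * (1 - Real.exp (-t)) := by
    have h1 : μ / n ≤ 1 := (div_le_one hn').2 hμn
    linarith [mul_le_mul_of_nonneg_right h1 hw, Real.exp_pos (-t)]
  refine prod_le_pow_of_sum_le hA (fun i => ?_) ?_
  · have := hq1 i; positivity
  have hterm : ∀ i, P.real {ω | X i ω = 0} * Real.exp (-(t * a i)) +
      (1 - P.real {ω | X i ω = 0}) * Real.exp (-(t * b i)) ≤
      1 - (∫ ω, Y i ω ∂P) * (1 - Real.exp (-t)) := fun i => by
    rw [integral_comp_two_point (hXm i) (hXbin i) (hY i) fun y => y]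
    have e1 := mul_le_mul_of_nonneg_left (exp_neg_mul_le (t := t) (ha i) ((hab i).trans (hb i)))
      (measureReal_nonneg (μ := P) (s := {ω | X i ω = 0}))
    have e2 := mul_le_mul_of_nonneg_left
      (exp_neg_mul_le (t := t) ((ha i).trans (hab i)) (hb i)) (hq1 i)
    linarith
  refine (Finset.sum_le_sum fun i _ => hterm i).trans ?_
  rw [Finset.sum_sub_distrib, ← Finset.sum_mul]
  have e : n * (1 - μ / n * (1 - Real.exp (-t))) = n - μ * (1 - Real.exp (-t)) := by
    field_simp
  rw [e]
  simp only [Finset.sum_const, Finset.card_univ, Fintype.card_fin, nsmul_eq_mul, mul_one]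
  linarith [mul_le_mul_of_nonneg_right hμ hw]

end LowerTail

/-! ### Assembling the bounds -/

theorem mainTheorem2 {Ω : Type*} [MeasurableSpace Ω] (P : Measure Ω) [IsProbabilityMeasure P]
    (n : ℕ) (X : Fin n → Ω → ℝ)
    (hXm : ∀ i, AEMeasurable (X i) P)
    (hXbin : ∀ i, ∀ᵐ ω ∂P, X i ω = 0 ∨ X i ω = 1)
    (hXneg : ZeroNegativelyCorrelated P X)
    (a b : Fin n → ℝ) (hab : ∀ i, a i ≤ b i)
    (Y : Fin n → Ω → ℝ)
    (hY : ∀ i, ∀ᵐ ω ∂P, (X i ω = 0 → Y i ω = a i) ∧ (X i ω = 1 → Y i ω = b i))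
    (μ : ℝ) (hμ : μ ≤ ∫ ω, ∑ i, Y i ω ∂P) :
    ((∀ i, a i ∈ Set.Icc (0 : ℝ) 1 ∧ b i ∈ Set.Icc (0 : ℝ) 1) →
      (∀ δ ∈ Set.Icc (0 : ℝ) 1,
        P.real {ω | ∑ i, Y i ω ≤ (1 - δ) * μ} ≤ multStrongest n μ δ ∧
        P.real {ω | ∑ i, Y i ω ≤ (1 - δ) * μ} ≤ multStrong μ δ ∧
        P.real {ω | ∑ i, Y i ω ≤ (1 - δ) * μ} ≤ multEasy μ δ) ∧
      (∀ lam : ℝ, 0 ≤ lam →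
        P.real {ω | ∑ i, Y i ω ≤ μ - lam} ≤ rangeBound n lam ∧
        P.real {ω | ∑ i, Y i ω ≤ μ - lam} ≤ addStrongest n μ lam ∧
        P.real {ω | ∑ i, Y i ω ≤ μ - lam} ≤ addStrong μ lam ∧
        P.real {ω | ∑ i, Y i ω ≤ μ - lam} ≤ addEasy μ lam ∧
        P.real {ω | ∑ i, Y i ω ≤ μ - lam} ≤ varStrongest n 1 (∑ i, variance (Y i) P) lam ∧
        P.real {ω | ∑ i, Y i ω ≤ μ - lam} ≤ varStrong 1 (∑ i, variance (Y i) P) lam ∧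
        P.real {ω | ∑ i, Y i ω ≤ μ - lam} ≤ varStrongAlt (∑ i, variance (Y i) P) lam ∧
        P.real {ω | ∑ i, Y i ω ≤ μ - lam} ≤ varLin 1 (∑ i, variance (Y i) P) lam ∧
        P.real {ω | ∑ i, Y i ω ≤ μ - lam} ≤ varMin 1 (∑ i, variance (Y i) P) lam)) ∧
    (∀ lam : ℝ, 0 ≤ lam →
      P.real {ω | ∑ i, Y i ω ≤ μ - lam} ≤ rangeBound (∑ i, (b i - a i) ^ 2) lam) ∧
    (∀ β : ℝ, 0 < β → (∀ i, ∀ᵐ ω ∂P, (∫ ω', Y i ω' ∂P) - β ≤ Y i ω) →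
      ∀ lam : ℝ, 0 ≤ lam →
        P.real {ω | ∑ i, Y i ω ≤ μ - lam} ≤ varStrongest n β (∑ i, variance (Y i) P) lam ∧
        P.real {ω | ∑ i, Y i ω ≤ μ - lam} ≤ varStrong β (∑ i, variance (Y i) P) lam ∧
        P.real {ω | ∑ i, Y i ω ≤ μ - lam} ≤ varLin β (∑ i, variance (Y i) P) lam ∧
        P.real {ω | ∑ i, Y i ω ≤ μ - lam} ≤ varMin β (∑ i, variance (Y i) P) lam) := by
  have hvar : ∀ β : ℝ, 0 < β → (∀ i, ∀ᵐ ω ∂P, (∫ ω', Y i ω' ∂P) - β ≤ Y i ω) →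
      ∀ lam : ℝ, 0 ≤ lam →
        P.real {ω | ∑ i, Y i ω ≤ μ - lam} ≤ varStrongest n β (∑ i, variance (Y i) P) lam ∧
        P.real {ω | ∑ i, Y i ω ≤ μ - lam} ≤ varStrong β (∑ i, variance (Y i) P) lam ∧
        P.real {ω | ∑ i, Y i ω ≤ μ - lam} ≤ varLin β (∑ i, variance (Y i) P) lam ∧
        P.real {ω | ∑ i, Y i ω ≤ μ - lam} ≤ varMin β (∑ i, variance (Y i) P) lam := by
    intro β hβ hYβ lam hlam
    have hV0 : 0 ≤ ∑ i, variance (Y i) P := Finset.sum_nonneg fun i _ => variance_nonneg _ _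
    obtain ⟨h1, h2⟩ := lower_tail_variance hXm hXbin hXneg hab hY hμ hβ hYβ hlam
    have h3 := h2.trans (varStrong_le_varLin hβ hV0 hlam)
    exact ⟨h1, h2, h3, h3.trans (varLin_le_varMin hβ hV0 hlam)⟩
  refine ⟨fun hI => ?_, fun lam hlam =>
    lower_tail_le_rangeBound hXm hXbin hXneg hab hY hμ hlam le_rfl, hvar⟩
  have ha : ∀ i, 0 ≤ a i := fun i => (hI i).1.1
  have hb : ∀ i, b i ≤ 1 := fun i => (hI i).2.2
  have hYI : ∀ i, ∀ᵐ ω ∂P, 0 ≤ Y i ω ∧ Y i ω ≤ 1 := fun i => by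
    filter_upwards [mem_Icc_two_point (hab i) (hXbin i) (hY i)] with ω h
    exact ⟨(ha i).trans h.1, h.2.trans (hb i)⟩
  have hm1 : ∀ i, ∫ ω, Y i ω ∂P ≤ 1 := fun i => by
    have h := integral_mono_ae (Integrable.of_mem_Icc 0 1
      (aemeasurable_two_point (hXm i) (hXbin i) (hY i)) (hYI i)) (integrable_const (1 : ℝ))
      ((hYI i).mono fun ω h => h.2)
    simpa using h
  have hμn : μ ≤ n := by
    rw [integral_sum_two_point hXm hXbin hab hY] at hμ
    refine hμ.trans ((Finset.sum_le_sum fun i _ => hm1 i).trans_eq ?_)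
    simp
  have hzero : ∀ x < 0, P.real {ω | ∑ i, Y i ω ≤ x} = 0 := fun x hx => by
    refine measureReal_le_eq_zero (f := fun ω => ∑ i, Y i ω) (c := 0) ?_ hx
    filter_upwards [ae_all_iff.2 hYI] with ω h
    exact Finset.sum_nonneg fun i _ => (h i).1
  have hadd : ∀ lam : ℝ, 0 ≤ lam →
      P.real {ω | ∑ i, Y i ω ≤ μ - lam} ≤ addStrongest n μ lam := by
    intro lam hlam
    rcases lt_or_ge μ lam with hlt | hle
    · rw [hzero _ (by linarith), addStrongest, if_pos hlt]
    · exact lower_tail_le_addStrongest hXm hXbin hXneg hab hY hμ ha hb hμn hlam hle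
  have hadd' : ∀ lam : ℝ, 0 ≤ lam →
      P.real {ω | ∑ i, Y i ω ≤ μ - lam} ≤ addStrong μ lam := fun lam hlam =>
    (hadd lam hlam).trans (addStrongest_le_addStrong hμn hlam)
  have hadd'' : ∀ lam : ℝ, 0 ≤ lam →
      P.real {ω | ∑ i, Y i ω ≤ μ - lam} ≤ addEasy μ lam := fun lam hlam =>
    (hadd' lam hlam).trans (addStrong_le_addEasy hlam)
  refine ⟨fun δ hδ => ?_, fun lam hlam => ?_⟩
  · obtain ⟨hδ0, hδ1⟩ := hδ
    -- Since only `μ ≤ E[Y]` is assumed, `μ` may be negative. Then the bounds are at least `1` for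
    -- `δ = 1`, and the event is null for `δ < 1`.
    rcases lt_or_ge μ 0 with hμ0 | hμ0
    · rcases hδ1.eq_or_lt with rfl | hδ1
      · have h1 : 1 ≤ 1 - μ / n := by
          have : μ / n ≤ 0 := div_nonpos_of_nonpos_of_nonneg hμ0.le (Nat.cast_nonneg n)
          linarith
        refine ⟨measureReal_le_one.trans ?_, measureReal_le_one.trans ?_,
          measureReal_le_one.trans ?_⟩
        · rw [multStrongest, if_pos rfl]
          exact one_le_pow₀ h1
        · rw [multStrong, sub_self, Real.rpow_zero, div_one, ← Real.exp_mul, Real.one_le_exp_iff]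
          linarith
        · rw [multEasy, Real.one_le_exp_iff]
          linarith
      · have h1 : 0 < 1 - δ := by linarith
        rw [hzero _ (mul_neg_of_pos_of_neg h1 hμ0)]
        refine ⟨?_, ?_, ?_⟩
        · rw [multStrongest, if_neg hδ1.ne]
          have h2 : (0 : ℝ) ≤ n := Nat.cast_nonneg n
          have h3 := mul_neg_of_pos_of_neg h1 hμ0
          have h4 : 0 ≤ (n - μ) / (n - (1 - δ) * μ) := div_nonneg (by linarith) (by linarith)
          positivity
        · unfold multStrong; positivity
        · unfold multEasy; positivity
    · have hl : 0 ≤ δ * μ := mul_nonneg hδ0 hμ0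
      rw [multStrongest_eq hμ0 hμn hδ1, multStrong_eq hμ0 hδ1, multEasy_eq,
        show (1 - δ) * μ = μ - δ * μ by ring]
      exact ⟨hadd _ hl, hadd' _ hl, hadd'' _ hl⟩
  -- Values in `[0,1]` allow `β = 1`: the means are at most `1` and the variables are nonnegative.
  · have hY1 : ∀ i, ∀ᵐ ω ∂P, (∫ ω', Y i ω' ∂P) - 1 ≤ Y i ω := fun i => by
      filter_upwards [hYI i] with ω h
      linarith [hm1 i, h.1]
    obtain ⟨h1, h2, h3, h4⟩ := hvar 1 one_pos hY1 lam hlam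
    refine ⟨lower_tail_le_rangeBound hXm hXbin hXneg hab hY hμ hlam ?_, hadd lam hlam,
      hadd' lam hlam, hadd'' lam hlam, h1, h2, h2.trans_eq (varStrong_one _ _ hlam), h3, h4⟩
    refine (Finset.sum_le_sum fun i _ => ?_).trans_eq (b := ∑ _i : Fin n, (1 : ℝ)) (by simp)
    exact pow_le_one₀ (sub_nonneg.2 (hab i)) (by linarith [ha i, hb i])
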